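/- Let $\mathcal G$ be a finite bipartite graph with left vertices $\widehat V$ (checks) and right vertices $V$ (qubits), and let $D,\widehat D$ be positive integers such that every $\hat v\in\widehat V$ has degree at most $\widehat D$ and every $v\in V$ has degree at most $D$. Let $d$ be the graph distance in $\mathcal G$. On the Hilbert space $\mathcal H=\bigotimes_{v\in V}\mathbb C^2$ let $X_v,Z_v$ be the Pauli operators on qubit $v$, and put $$F_{\hat v}=\prod_{v\sim\hat v}Z_v,\qquad P_v=\tfrac12(1-X_v),\qquad Q_{\hat v}=\tfrac12(1-F_{\hat v}).$$ For a subgraph $A$ of $\mathcal G$ with vertex set $\widehat V_A\sqcup V_A$ let $$H'_A=\sum_{v\in V_A,\ \hat v\in\widehat V_A,\ d(v,\hat v)=3}P_vQ_{\hat v},$$ and let $\Pi_A$ be the orthogonal projection of $\mathcal H$ onto the ground space $\ker H'_A$. For orthogonal projections $\Pi_1,\Pi_2$ let $\Pi_1\wedge\Pi_2$ be the orthogonal projection onto $\operatorname{im}\Pi_1\cap\operatorname{im}\Pi_2$. A subgraph $A$ is called left-closed if every $\hat v\in\widehat V_A$ has the same neighbours in $A$ as in $\mathcal G$. Unions and intersections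 of subgraphs are taken on both vertices and edges. Let $A$ and $B$ be connected, induced, left-closed subgraphs of $\mathcal G$ with $|V_A|>2D\widehat D$ and $|V_B|>2D\widehat D$, such that $V_{A\cap B}=V_A\cap V_B\neq\emptyset$ and $\widehat V_{A\cap B}=\widehat V_A\cap\widehat V_B\neq\emptyset$. Then $$\Pi_A\wedge\Pi_B=\Pi_{A\cup B},$$ and the martingale function satisfies, in operator norm, $$\delta(A,B):=\lVert\Pi_A\Pi_B-\Pi_A\wedge\Pi_B\rVert\ \le\ \frac{3\sqrt2}{\sqrt2-1}\;2^{-|V_{A\cap B}|/(4\max(D,\widehat D))}.$$ -/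

import Mathlib

/-! A bipartite graph with left vertices `Vh` (the checks) and right vertices `V` (the qubits) is a
`G : SimpleGraph (Vh ⊕ V)` with `G.IsBipartiteWith (Set.range Sum.inl) (Set.range Sum.inr)`. -/

namespace DeformedLDPC

/-! ### Subgraphs of a bipartite graph -/

/-- A subgraph is left-closed if each of its left vertices has the same neighbours in the subgraph
as in the whole graph. -/
def LeftClosed {Vh V : Type*} {G : SimpleGraph (Vh ⊕ V)} (A : G.Subgraph) : Prop :=
  ∀ c : Vh, Sum.inl c ∈ A.verts → A.neighborSet (Sum.inl c) = G.neighborSet (Sum.inl c)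

/-- The left vertices (checks) of a subgraph. -/
def leftVerts {Vh V : Type*} {G : SimpleGraph (Vh ⊕ V)} (A : G.Subgraph) : Set Vh :=
  {c | Sum.inl c ∈ A.verts}

/-- The right vertices (qubits) of a subgraph. -/
def rightVerts {Vh V : Type*} {G : SimpleGraph (Vh ⊕ V)} (A : G.Subgraph) : Set V :=
  {v | Sum.inr v ∈ A.verts}

/-! ### Qubits and Pauli operators -/

/-- The Hilbert space `⨂_{v ∈ V} ℂ²` of qubits on `V`, in coordinates with respect to the
orthonormal basis of `Z`-eigenstates `|s⟩`, `s ∈ {0,1}^V`. -/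
abbrev QubitSpace (V : Type*) [Fintype V] : Type _ :=
  EuclideanSpace ℂ (V → ZMod 2)

/-- The Pauli operator `X_v`, which flips the `v`-th bit: `X_v |s⟩ = |s + e_v⟩`. -/
def pauliX {V : Type*} [Fintype V] [DecidableEq V] (v : V) : Module.End ℂ (QubitSpace V) where
  toFun ψ := WithLp.toLp 2 fun s => ψ (s + Pi.single v 1)
  map_add' _ _ := by ext s; simp
  map_smul' _ _ := by ext s; simp

/-- The Pauli operator `Z_v`, diagonal in the basis `|s⟩` with eigenvalues `(-1)^{s_v}`. -/
def pauliZ {V : Type*} [Fintype V] (v : V) : Module.End ℂ (QubitSpace V) where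
  toFun ψ := WithLp.toLp 2 fun s => (-1 : ℂ) ^ (s v).val * ψ s
  map_add' _ _ := by ext s; simp [mul_add]
  map_smul' _ _ := by ext s; simp [mul_left_comm]

theorem pauliZ_pairwise_commute {V : Type*} [Fintype V] (S : Finset V) :
    (S : Set V).Pairwise (Function.onFun Commute pauliZ) := by
  intro v _ w _ _
  change pauliZ v * pauliZ w = pauliZ w * pauliZ v
  ext ψ s
  simp [pauliZ, mul_left_comm]

open Classical in
/-- The check operator `F_c = ∏_{v ∼ c} Z_v`. -/
noncomputable def checkF {Vh V : Type*} [Fintype V] (G : SimpleGraph (Vh ⊕ V)) (c : Vh) :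
    Module.End ℂ (QubitSpace V) :=
  (Finset.univ.filter fun v : V => G.Adj (Sum.inr v) (Sum.inl c)).noncommProd pauliZ
    (pauliZ_pairwise_commute _)

/-- The projection `P_v = (1 - X_v) / 2`. -/
noncomputable def projP {V : Type*} [Fintype V] [DecidableEq V] (v : V) :
    Module.End ℂ (QubitSpace V) :=
  (1 / 2 : ℂ) • (1 - pauliX v)

/-- The projection `Q_c = (1 - F_c) / 2`. -/
noncomputable def projQ {Vh V : Type*} [Fintype V] (G : SimpleGraph (Vh ⊕ V)) (c : Vh) :
    Module.End ℂ (QubitSpace V) :=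
  (1 / 2 : ℂ) • (1 - checkF G c)

/-! ### Local Hamiltonians and ground-space projections -/

open Classical in
/-- The local Hamiltonian `H'_A = ∑ P_v Q_c`, summed over the pairs of a qubit `v` of `A` and a
check `c` of `A` whose distance in the whole graph `G` is `3`. It acts on all the qubits of `V`,
trivially on those outside `A` if `A` is left-closed. -/
noncomputable def localHamiltonian {Vh V : Type*} [Fintype Vh] [Fintype V] [DecidableEq V]
    {G : SimpleGraph (Vh ⊕ V)} (A : G.Subgraph) : Module.End ℂ (QubitSpace V) :=
  ∑ p ∈ Finset.univ.filter (fun p : V × Vh =>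
      p.1 ∈ rightVerts A ∧ p.2 ∈ leftVerts A ∧ G.dist (Sum.inr p.1) (Sum.inl p.2) = 3),
    projP p.1 * projQ G p.2

/-- The ground space of `H'_A`, a positive semidefinite operator with nontrivial kernel: the
space of zero-energy states. -/
noncomputable def groundSpace {Vh V : Type*} [Fintype Vh] [Fintype V] [DecidableEq V]
    {G : SimpleGraph (Vh ⊕ V)} (A : G.Subgraph) : Submodule ℂ (QubitSpace V) :=
  LinearMap.ker (localHamiltonian A)

/-- The orthogonal projection `Π_A` onto the ground space of `H'_A`. -/
noncomputable def groundProj {Vh V : Type*} [Fintype Vh] [Fintype V] [DecidableEq V]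
    {G : SimpleGraph (Vh ⊕ V)} (A : G.Subgraph) : QubitSpace V →L[ℂ] QubitSpace V :=
  (groundSpace A).starProjection

/-- `P ∧ Q`: the orthogonal projection onto `im P ∩ im Q`. -/
noncomputable def projMeet {E : Type*} [NormedAddCommGroup E] [InnerProductSpace ℂ E]
    [FiniteDimensional ℂ E] (P Q : E →L[ℂ] E) : E →L[ℂ] E :=
  (LinearMap.range P.toLinearMap ⊓ LinearMap.range Q.toLinearMap).starProjection

/-- The martingale function `δ(A,B) = ‖Π_A Π_B - Π_A ∧ Π_B‖` (operator norm). -/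
noncomputable def martingaleDelta {Vh V : Type*} [Fintype Vh] [Fintype V] [DecidableEq V]
    {G : SimpleGraph (Vh ⊕ V)} (A B : G.Subgraph) : ℝ :=
  ‖groundProj A * groundProj B - projMeet (groundProj A) (groundProj B)‖

end DeformedLDPC

namespace DeformedLDPC

/-! ### Syndromes -/

/-! In the `Z` basis the energy of `P_v Q_c` at `ψ` is a sum of `|ψ s - ψ (s + e_v)|² / 4` over the
strings `s` violating `c`. So `ψ` is a ground state iff such flips, for all pairs at distance 3,
leave its values unchanged. Connectedness extends this from distance 3 to every check `c` and qubit
`v ∉ c` of `A` (`groundSpace_flip`), and the size of `A` supplies a spare qubit that handles pairs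
of qubits inside `c` (`groundSpace_flip_pair`). Hence (`groundSpace_const`) a ground state is
arbitrary on the code strings, those satisfying all checks of `A`, and elsewhere equals a function
`f` of the qubits outside `A`.

For the union, a check common to `A` and `B` can be violated at no cost by flipping one of its
qubits. It then licenses flips in `B` that were so far justified only in `A`, and conversely
(`groundSpace_inf_flip`).

For the martingale bound, take ground states `φ` of `A` and `ψ` of `B`, orthogonal to the common
ground space, with outer functions `f` and `g`. Both ignore the qubits of `A ∩ B`. A set `T` of at
least `|V_{A ∩ B}| / Dh` of these supports no nonzero string satisfying all the checks
(`exists_isolating_subset`), so code strings carry at most `2 ^ (-|T|)` of the mass of `f` or `g`.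
Thus `⟨φ, ψ⟩` is `⟨f, g⟩` up to small terms. Finally `⟨f, g⟩ = ⟨F, g⟩` with `F` the average of `f`
over the qubits of `B`; since `F` ignores the qubits of both `A` and `B`, `φ` is orthogonal to it,
which makes `F` small (`norm_inner_le_of_orthogonal`). -/

theorem not_adj_of_dist_eq_three {Vh V : Type*} {G : SimpleGraph (Vh ⊕ V)} {v : V}
    {c : Vh} (h : G.dist (Sum.inr v) (Sum.inl c) = 3) :
    ¬ G.Adj (Sum.inr v) (Sum.inl c) := fun h' => by
  rw [SimpleGraph.dist_eq_one_iff_adj.2 h'] at h; omega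

theorem add_single_add_single {V : Type*} [DecidableEq V] (s : V → ZMod 2) (v : V) :
    s + Pi.single v 1 + Pi.single v 1 = s := by
  rw [add_assoc, ← Pi.single_add, CharTwo.add_self_eq_zero, Pi.single_zero, add_zero]

open Classical in
/-- The value of the check `c` on the bit string `s`. -/
noncomputable def parity {Vh V : Type*} [Fintype V] (G : SimpleGraph (Vh ⊕ V)) (c : Vh)
    (s : V → ZMod 2) : ZMod 2 :=
  ∑ v with G.Adj (Sum.inr v) (Sum.inl c), s v

/-- A bit string is frustrated on `A` if it violates a check of `A`. -/
def Frustrated {Vh V : Type*} [Fintype V] {G : SimpleGraph (Vh ⊕ V)} (A : G.Subgraph)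
    (s : V → ZMod 2) : Prop :=
  ∃ c ∈ leftVerts A, parity G c s ≠ 0

section

variable {Vh V : Type*} [Fintype V] {G : SimpleGraph (Vh ⊕ V)}

theorem parity_add (c : Vh) (s t : V → ZMod 2) :
    parity G c (s + t) = parity G c s + parity G c t := by
  simp [parity, Finset.sum_add_distrib]

theorem parity_sum {ι : Type*} (c : Vh) (T : Finset ι) (s : ι → V → ZMod 2) :
    parity G c (∑ i ∈ T, s i) = ∑ i ∈ T, parity G c (s i) := by
  simp only [parity, Finset.sum_apply]
  exact Finset.sum_comm

open Classical in
theorem parity_single (c : Vh) (v : V) :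
    parity G c (Pi.single v 1) = if G.Adj (Sum.inr v) (Sum.inl c) then 1 else 0 := by
  simp [parity, Pi.single_apply]

theorem parity_single_of_adj [DecidableEq V] {c : Vh} {v : V}
    (h : G.Adj (Sum.inr v) (Sum.inl c)) : parity G c (Pi.single v 1) = 1 := by
  convert (parity_single (G := G) c v).trans (if_pos h)

theorem parity_single_of_not_adj [DecidableEq V] {c : Vh} {v : V}
    (h : ¬ G.Adj (Sum.inr v) (Sum.inl c)) : parity G c (Pi.single v 1) = 0 := by
  convert (parity_single (G := G) c v).trans (if_neg h)

theorem parity_add_single_of_adj [DecidableEq V] {c : Vh} {v : V}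
    (h : G.Adj (Sum.inr v) (Sum.inl c)) (s : V → ZMod 2) :
    parity G c (s + Pi.single v 1) = parity G c s + 1 := by
  rw [parity_add, parity_single_of_adj h]

theorem parity_add_single_of_not_adj [DecidableEq V] {c : Vh} {v : V}
    (h : ¬ G.Adj (Sum.inr v) (Sum.inl c)) (s : V → ZMod 2) :
    parity G c (s + Pi.single v 1) = parity G c s := by
  rw [parity_add, parity_single_of_not_adj h, add_zero]

/-! ### The ground space in coordinates -/

theorem checkF_apply (c : Vh) (ψ : QubitSpace V) (s : V → ZMod 2) :
    (checkF G c ψ) s = (if parity G c s ≠ 0 then -1 else 1) * ψ s := by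
  classical
  have key : ∀ S : Finset V, (S.noncommProd pauliZ (pauliZ_pairwise_commute S) ψ) s =
      (if ∑ v ∈ S, s v ≠ 0 then -1 else 1) * ψ s := by
    intro S
    induction S using Finset.induction_on with
    | empty => simp
    | insert a S ha ih =>
      rw [Finset.noncommProd_insert_of_notMem _ _ _ _ ha, Finset.sum_insert ha]
      change (-1 : ℂ) ^ (s a).val * _ = _
      rw [ih, ← mul_assoc]
      congr 1
      have h01 : ∀ x : ZMod 2, x = 0 ∨ x = 1 := by decide
      have h11 : (1 : ZMod 2) + 1 = 0 := by decide
      have hv : (1 : ZMod 2).val = 1 := rfl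
      rcases h01 (∑ v ∈ S, s v) with hy | hy <;> rcases h01 (s a) with hx | hx <;>
        simp [hx, hy, h11, hv]
  exact key _

theorem projQ_apply (c : Vh) (ψ : QubitSpace V) (s : V → ZMod 2) :
    (projQ G c ψ) s = if parity G c s ≠ 0 then ψ s else 0 := by
  have h : (projQ G c ψ) s = (1 / 2 : ℂ) * (ψ s - (checkF G c ψ) s) := rfl
  rw [h, checkF_apply]
  split_ifs <;> ring

variable [DecidableEq V]

theorem projP_apply (v : V) (ψ : QubitSpace V) (s : V → ZMod 2) :
    (projP v ψ) s = (1 / 2 : ℂ) * (ψ s - ψ (s + Pi.single v 1)) := rfl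

theorem projP_mul_projQ_apply {v : V} {c : Vh} (h : ¬ G.Adj (Sum.inr v) (Sum.inl c))
    (ψ : QubitSpace V) (s : V → ZMod 2) :
    ((projP v * projQ G c) ψ) s =
      if parity G c s ≠ 0 then (1 / 2 : ℂ) * (ψ s - ψ (s + Pi.single v 1)) else 0 := by
  rw [Module.End.mul_apply, projP_apply, projQ_apply, projQ_apply, parity_add_single_of_not_adj h]
  split_ifs <;> simp

/-- Flipping `v` preserves the parity of `c`, so the sum can be symmetrized under the flip, which
completes the square. -/
theorem inner_projP_mul_projQ {v : V} {c : Vh} (h : ¬ G.Adj (Sum.inr v) (Sum.inl c))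
    (ψ : QubitSpace V) :
    inner ℂ ψ ((projP v * projQ G c) ψ) =
      ((∑ s : V → ZMod 2, if parity G c s ≠ 0 then
        ‖ψ s - ψ (s + Pi.single v 1)‖ ^ 2 / 4 else 0 : ℝ) : ℂ) := by
  have h1 : inner ℂ ψ ((projP v * projQ G c) ψ) = ∑ s : V → ZMod 2,
      if parity G c s ≠ 0 then
        (1 / 2 : ℂ) * (ψ s - ψ (s + Pi.single v 1)) * star (ψ s) else 0 := by
    rw [PiLp.inner_apply]
    refine Finset.sum_congr rfl fun s _ => ?_
    rw [projP_mul_projQ_apply h]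
    split_ifs <;> simp [mul_comm]
  have h2 : inner ℂ ψ ((projP v * projQ G c) ψ) = ∑ s : V → ZMod 2,
      if parity G c s ≠ 0 then
        (1 / 2 : ℂ) * (ψ (s + Pi.single v 1) - ψ s) * star (ψ (s + Pi.single v 1)) else 0 := by
    rw [h1, ← Equiv.sum_comp (Equiv.addRight (Pi.single v 1 : V → ZMod 2))]
    refine Finset.sum_congr rfl fun s _ => ?_
    simp only [Equiv.coe_addRight, parity_add_single_of_not_adj h, add_single_add_single]
  have h3 : (2 : ℂ) * inner ℂ ψ ((projP v * projQ G c) ψ) = 2 * ((∑ s : V → ZMod 2,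
      if parity G c s ≠ 0 then ‖ψ s - ψ (s + Pi.single v 1)‖ ^ 2 / 4 else 0 : ℝ) : ℂ) := by
    rw [two_mul]
    nth_rw 1 [h1]
    rw [h2, ← Finset.sum_add_distrib]
    push_cast
    rw [Finset.mul_sum]
    refine Finset.sum_congr rfl fun s _ => ?_
    split_ifs
    · push_cast
      rw [← Complex.mul_conj']
      simp only [map_sub, ← starRingEnd_apply]
      ring
    · simp
  exact mul_left_cancel₀ two_ne_zero h3

/-- Frustration-freeness: a sum of nonnegative energies vanishes only if each of them does. -/
theorem mem_groundSpace_iff [Fintype Vh] {A : G.Subgraph} {ψ : QubitSpace V} :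
    ψ ∈ groundSpace A ↔ ∀ v ∈ rightVerts A, ∀ c ∈ leftVerts A,
      G.dist (Sum.inr v) (Sum.inl c) = 3 → ∀ s, parity G c s ≠ 0 →
        ψ (s + Pi.single v 1) = ψ s := by
  classical
  rw [groundSpace, LinearMap.mem_ker, localHamiltonian, LinearMap.sum_apply]
  constructor
  · intro h v hv c hc hd s hs
    have h0 := congrArg (inner ℂ ψ) h
    rw [inner_sum, inner_zero_right, Finset.sum_congr rfl fun p hp =>
      inner_projP_mul_projQ (not_adj_of_dist_eq_three (Finset.mem_filter.1 hp).2.2.2) ψ,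
      ← Complex.ofReal_sum, Complex.ofReal_eq_zero, Finset.sum_eq_zero_iff_of_nonneg] at h0
    · have h1 := h0 (v, c) (by simp [hv, hc, hd])
      rw [Finset.sum_eq_zero_iff_of_nonneg fun s _ => by split_ifs <;> positivity] at h1
      have h2 := h1 s (Finset.mem_univ _)
      rw [if_pos hs] at h2
      have h3 : ‖ψ s - ψ (s + Pi.single v 1)‖ = 0 := by
        have : ‖ψ s - ψ (s + Pi.single v 1)‖ ^ 2 = 0 := by linarith
        exact pow_eq_zero_iff two_ne_zero |>.1 this
      exact (sub_eq_zero.1 (norm_eq_zero.1 h3)).symm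
    · intro p _
      exact Finset.sum_nonneg fun s _ => by split_ifs <;> positivity
  · intro h
    refine Finset.sum_eq_zero fun p hp => ?_
    obtain ⟨-, h1, h2, h3⟩ := Finset.mem_filter.1 hp
    ext s
    rw [projP_mul_projQ_apply (not_adj_of_dist_eq_three h3)]
    split_ifs with hs
    · simp [h _ h1 _ h2 h3 s hs]
    · rfl

end

/-! ### Bipartite geometry -/

section

variable {Vh V : Type*} {G : SimpleGraph (Vh ⊕ V)}

theorem not_adj_inl_inl (hG : G.IsBipartiteWith (Set.range Sum.inl) (Set.range Sum.inr))
    (c c' : Vh) : ¬ G.Adj (Sum.inl c) (Sum.inl c') := fun h => by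
  rcases hG.mem_of_adj h with ⟨-, ⟨_, h⟩⟩ | ⟨⟨_, h⟩, -⟩ <;> simp at h

theorem not_adj_inr_inr (hG : G.IsBipartiteWith (Set.range Sum.inl) (Set.range Sum.inr))
    (v v' : V) : ¬ G.Adj (Sum.inr v) (Sum.inr v') := fun h => by
  rcases hG.mem_of_adj h with ⟨⟨_, h⟩, -⟩ | ⟨-, ⟨_, h⟩⟩ <;> simp at h

/-- The walk `v, c', w, c` has length 3; bipartiteness excludes length 2 and `hvc` excludes length
1. -/
theorem dist_eq_three (hG : G.IsBipartiteWith (Set.range Sum.inl) (Set.range Sum.inr))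
    {v w : V} {c c' : Vh} (hvc : ¬ G.Adj (Sum.inr v) (Sum.inl c))
    (hwc : G.Adj (Sum.inr w) (Sum.inl c)) (hwc' : G.Adj (Sum.inr w) (Sum.inl c'))
    (hvc' : G.Adj (Sum.inr v) (Sum.inl c')) : G.dist (Sum.inr v) (Sum.inl c) = 3 := by
  let p : G.Walk (Sum.inr v) (Sum.inl c) :=
    SimpleGraph.Walk.cons hvc' (SimpleGraph.Walk.cons hwc'.symm hwc.toWalk)
  have hle : G.dist (Sum.inr v) (Sum.inl c) ≤ 3 := SimpleGraph.dist_le p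
  obtain ⟨q, hq⟩ := p.reachable.exists_walk_length_eq_dist
  rw [← hq] at hle ⊢
  match q, hle with
  | .cons h .nil, _ => exact absurd h hvc
  | .cons (v := x) h (.cons h' .nil), _ =>
    rcases x with x | x
    · exact absurd h' (not_adj_inl_inl hG _ _)
    · exact absurd h (not_adj_inr_inr hG _ _)
  | .cons _ (.cons _ (.cons _ q)), hle =>
    simp only [SimpleGraph.Walk.length_cons] at hle ⊢
    omega

theorem subgraph_induction {W : Type*} {H : SimpleGraph W} {A : H.Subgraph} (hA : A.Connected)
    {P : W → Prop} {a b : W} (ha : a ∈ A.verts) (hb : b ∈ A.verts) (h0 : P a)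
    (hstep : ∀ x y, A.Adj x y → P x → P y) : P b := by
  obtain ⟨p⟩ := hA.coe.preconnected ⟨a, ha⟩ ⟨b, hb⟩
  have key : ∀ (x y : A.verts) (_ : A.coe.Walk x y), P x → P y := by
    intro x y p
    induction p with
    | nil => exact id
    | cons h _ ih => exact fun hx => ih (hstep _ _ h hx)
  exact key _ _ p h0

theorem exists_adj_of_connected {W : Type*} {H : SimpleGraph W} {A : H.Subgraph}
    (hA : A.Connected) {a b : W} (ha : a ∈ A.verts) (hb : b ∈ A.verts) (hab : a ≠ b) :
    ∃ x, A.Adj a x := by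
  by_contra! h
  exact hab.symm (subgraph_induction (P := fun x => x = a) hA ha hb rfl
    fun x y hxy hx => absurd (hx ▸ hxy) (h y))

theorem LeftClosed.mem_rightVerts {A : G.Subgraph} (hA : LeftClosed A) {c : Vh}
    (hc : c ∈ leftVerts A) {v : V} (h : G.Adj (Sum.inr v) (Sum.inl c)) : v ∈ rightVerts A := by
  have h1 : Sum.inr v ∈ A.neighborSet (Sum.inl c) := by rw [hA c hc]; exact h.symm
  exact A.edge_vert (A.adj_symm h1)

theorem exists_qubit_of_check
    (hG : G.IsBipartiteWith (Set.range Sum.inl) (Set.range Sum.inr)) {A : G.Subgraph}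
    (hA : A.Connected) {c : Vh} (hc : c ∈ leftVerts A) (hne : (rightVerts A).Nonempty) :
    ∃ v ∈ rightVerts A, G.Adj (Sum.inr v) (Sum.inl c) := by
  obtain ⟨w, hw⟩ := hne
  obtain ⟨x | x, hx⟩ := exists_adj_of_connected hA hc hw (by simp)
  · exact absurd hx.adj_sub (not_adj_inl_inl hG _ _)
  · exact ⟨x, A.edge_vert (A.adj_symm hx), hx.adj_sub.symm⟩

theorem exists_check_of_qubit
    (hG : G.IsBipartiteWith (Set.range Sum.inl) (Set.range Sum.inr)) {A : G.Subgraph}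
    (hA : A.Connected) {v : V} (hv : v ∈ rightVerts A) (hne : (leftVerts A).Nonempty) :
    ∃ c ∈ leftVerts A, G.Adj (Sum.inr v) (Sum.inl c) := by
  obtain ⟨w, hw⟩ := hne
  obtain ⟨x | x, hx⟩ := exists_adj_of_connected hA hv hw (by simp)
  · exact ⟨x, A.edge_vert (A.adj_symm hx), hx.adj_sub⟩
  · exact absurd hx.adj_sub (not_adj_inr_inr hG _ _)

open Classical in
/-- The qubits that take part in a check `c`. -/
noncomputable def checkSupport [Fintype V] (G : SimpleGraph (Vh ⊕ V)) (c : Vh) : Finset V :=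
  {v | G.Adj (Sum.inr v) (Sum.inl c)}

open Classical in
/-- The checks in which a qubit `v` takes part. -/
noncomputable def qubitChecks [Fintype Vh] (G : SimpleGraph (Vh ⊕ V)) (v : V) : Finset Vh :=
  {c | G.Adj (Sum.inr v) (Sum.inl c)}

theorem mem_checkSupport [Fintype V] {c : Vh} {v : V} :
    v ∈ checkSupport G c ↔ G.Adj (Sum.inr v) (Sum.inl c) := by simp [checkSupport]

theorem mem_qubitChecks [Fintype Vh] {c : Vh} {v : V} :
    c ∈ qubitChecks G v ↔ G.Adj (Sum.inr v) (Sum.inl c) := by simp [qubitChecks]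

theorem card_checkSupport_le [Fintype Vh] [Fintype V] [DecidableRel G.Adj] (c : Vh) :
    (checkSupport G c).card ≤ G.degree (Sum.inl c) := by
  rw [← SimpleGraph.card_neighborFinset_eq_degree, ← Finset.card_map Function.Embedding.inr]
  refine Finset.card_le_card fun x hx => ?_
  obtain ⟨v, hv, rfl⟩ := Finset.mem_map.1 hx
  exact (SimpleGraph.mem_neighborFinset _ _ _).2 (mem_checkSupport.1 hv).symm

theorem card_qubitChecks_le [Fintype Vh] [Fintype V] [DecidableRel G.Adj] (v : V) :
    (qubitChecks G v).card ≤ G.degree (Sum.inr v) := by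
  rw [← SimpleGraph.card_neighborFinset_eq_degree, ← Finset.card_map Function.Embedding.inl]
  refine Finset.card_le_card fun x hx => ?_
  obtain ⟨v, hv, rfl⟩ := Finset.mem_map.1 hx
  exact (SimpleGraph.mem_neighborFinset _ _ _).2 (mem_qubitChecks.1 hv)

/-- In a large subgraph, some qubit shares no check with either of two given qubits. -/
theorem exists_separated_qubit [Fintype Vh] [Fintype V] {D Dh : ℕ}
    (hleft : ∀ c : Vh, (checkSupport G c).card ≤ Dh)
    (hright : ∀ v : V, (qubitChecks G v).card ≤ D) {A : G.Subgraph}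
    (hcard : 2 * D * Dh < (rightVerts A).ncard) (v w : V) :
    ∃ u ∈ rightVerts A, ∀ c, G.Adj (Sum.inr u) (Sum.inl c) →
      ¬ G.Adj (Sum.inr v) (Sum.inl c) ∧ ¬ G.Adj (Sum.inr w) (Sum.inl c) := by
  classical
  have hle : ((qubitChecks G v ∪ qubitChecks G w).biUnion (checkSupport G)).card
      ≤ 2 * D * Dh := by
    refine (Finset.card_biUnion_le_card_mul _ _ Dh fun c _ => hleft c).trans ?_
    refine Nat.mul_le_mul_right _ ((Finset.card_union_le _ _).trans ?_)
    have := hright v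
    have := hright w
    omega
  rw [← Set.ncard_coe_finset] at hle
  obtain ⟨u, hu, hu'⟩ := Set.exists_mem_notMem_of_ncard_lt_ncard (hle.trans_lt hcard)
  refine ⟨u, hu, fun c hc => ?_⟩
  rw [← not_or]
  refine fun h => hu' (Finset.mem_coe.2 (Finset.mem_biUnion.2 ⟨c, ?_, mem_checkSupport.2 hc⟩))
  simpa [mem_qubitChecks] using h

end

/-! ### Ground states are constant on frustrated strings -/

section

variable {Vh V : Type*} [Fintype Vh] [Fintype V] [DecidableEq V] {G : SimpleGraph (Vh ⊕ V)}
  {A : G.Subgraph} {ψ : QubitSpace V}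

/-- Distance 3 is the base case; the flip rule is carried to farther checks along a path in `A`
starting at `v`. -/
theorem groundSpace_flip (hG : G.IsBipartiteWith (Set.range Sum.inl) (Set.range Sum.inr))
    (hA : A.Connected) (hψ : ψ ∈ groundSpace A) {v : V}
    (hv : v ∈ rightVerts A) {c : Vh} (hc : c ∈ leftVerts A)
    (hvc : ¬ G.Adj (Sum.inr v) (Sum.inl c)) {s : V → ZMod 2} (hs : parity G c s ≠ 0) :
    ψ (s + Pi.single v 1) = ψ s := by
  rw [mem_groundSpace_iff] at hψ
  let good (c₀ : Vh) : Prop := ¬ G.Adj (Sum.inr v) (Sum.inl c₀) →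
    ∀ s, parity G c₀ s ≠ 0 → ψ (s + Pi.single v 1) = ψ s
  -- The invariant along the path: the flip rule holds for the checks containing the current qubit,
  -- or for those sharing a qubit with the current check. It is vacuous at `v` itself.
  let P : Vh ⊕ V → Prop := Sum.elim
    (fun c => ∀ c₀ ∈ leftVerts A, ∀ w, G.Adj (Sum.inr w) (Sum.inl c₀) →
      G.Adj (Sum.inr w) (Sum.inl c) → good c₀)
    (fun w => ∀ c₀ ∈ leftVerts A, G.Adj (Sum.inr w) (Sum.inl c₀) → good c₀)
  have hPr : P (Sum.inr v) := fun c₀ _ h h' => absurd h h'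
  have hPl : P (Sum.inl c) := by
    refine subgraph_induction (P := P) hA hv hc hPr ?_
    rintro (c | w) (c' | w') hadj hP
    · exact absurd hadj.adj_sub (not_adj_inl_inl hG _ _)
    · exact fun c₀ hc₀ h => hP c₀ hc₀ w' h hadj.adj_sub.symm
    · intro c₀ hc₀ u hu hu' hvc₀ s hs
      by_cases hvc' : G.Adj (Sum.inr v) (Sum.inl c')
      · exact hψ v hv c₀ hc₀ (dist_eq_three hG hvc₀ hu hu' hvc') s hs
      by_cases hwc₀ : G.Adj (Sum.inr w) (Sum.inl c₀)
      · exact hP c₀ hc₀ hwc₀ hvc₀ s hs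
      have hc' : c' ∈ leftVerts A := A.edge_vert (A.adj_symm hadj)
      by_cases hs' : parity G c' s = 0
      -- When `c'` is satisfied, flip `w` first: it is at distance 3 from `c₀`, so this is free both
      -- before and after flipping `v`, and it violates `c'`, which then permits the flip of `v`.
      · have hw : w ∈ rightVerts A := A.edge_vert hadj
        have hd := hψ w hw c₀ hc₀ (dist_eq_three hG hwc₀ hu hu' hadj.adj_sub)
        rw [← hd s hs, ← hd (s + Pi.single v 1) (by rwa [parity_add_single_of_not_adj hvc₀]),
          add_right_comm]
        refine hP c' hc' hadj.adj_sub hvc' _ ?_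
        rw [parity_add_single_of_adj hadj.adj_sub, hs']
        decide
      · exact hP c' hc' hadj.adj_sub hvc' s hs'
    · exact absurd hadj.adj_sub (not_adj_inr_inr hG _ _)
  obtain ⟨w, -, hw⟩ := exists_qubit_of_check hG hA hc ⟨v, hv⟩
  exact hPl c hc w hw hw hvc s hs

/-- Flipping two qubits of a violated check does not change a ground state. -/
theorem groundSpace_flip_pair
    (hG : G.IsBipartiteWith (Set.range Sum.inl) (Set.range Sum.inr)) {D Dh : ℕ}
    (hleft : ∀ c : Vh, (checkSupport G c).card ≤ Dh)
    (hright : ∀ v : V, (qubitChecks G v).card ≤ D)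
    (hcard : 2 * D * Dh < (rightVerts A).ncard)
    (hA : A.Connected) (hψ : ψ ∈ groundSpace A) {v w : V}
    (hv : v ∈ rightVerts A) (hw : w ∈ rightVerts A) {c : Vh} (hc : c ∈ leftVerts A)
    (hvc : G.Adj (Sum.inr v) (Sum.inl c)) (hwc : G.Adj (Sum.inr w) (Sum.inl c))
    {s : V → ZMod 2} (hs : parity G c s ≠ 0) :
    ψ (s + (Pi.single v 1 + Pi.single w 1)) = ψ s := by
  obtain ⟨u, hu, hsep⟩ := exists_separated_qubit hleft hright hcard v w
  obtain ⟨c', hc', huc'⟩ := exists_check_of_qubit hG hA hu ⟨c, hc⟩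
  obtain ⟨hvc', hwc'⟩ := hsep c' huc'
  have huc : ¬ G.Adj (Sum.inr u) (Sum.inl c) := fun h => (hsep c h).1 hvc
  have key : ∀ s, parity G c' s ≠ 0 → ψ (s + (Pi.single v 1 + Pi.single w 1)) = ψ s := by
    intro s hs
    rw [← add_assoc, groundSpace_flip hG hA hψ hw hc' hwc'
      (by rwa [parity_add_single_of_not_adj hvc']), groundSpace_flip hG hA hψ hv hc' hvc' hs]
  -- If `c'` is violated, it permits the flips of `v` and `w` one at a time. Otherwise flip `u` to
  -- violate it; `c` pays for that on both sides, since the pair flip preserves its parity.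
  by_cases hs' : parity G c' s = 0
  · rw [← groundSpace_flip hG hA hψ hu hc huc hs,
      ← groundSpace_flip hG hA hψ hu hc huc (s := s + _), add_right_comm]
    · refine key _ ?_
      rw [parity_add_single_of_adj huc', hs']
      decide
    · rw [parity_add, parity_add, parity_single_of_adj hvc, parity_single_of_adj hwc]
      rwa [CharTwo.add_self_eq_zero, add_zero]
  · exact key s hs'

theorem groundSpace_const_of_check
    (hG : G.IsBipartiteWith (Set.range Sum.inl) (Set.range Sum.inr)) {D Dh : ℕ}
    (hleft : ∀ c : Vh, (checkSupport G c).card ≤ Dh)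
    (hright : ∀ v : V, (qubitChecks G v).card ≤ D)
    (hcard : 2 * D * Dh < (rightVerts A).ncard)
    (hA : A.Connected) (hψ : ψ ∈ groundSpace A) {c : Vh}
    (hc : c ∈ leftVerts A) {s t : V → ZMod 2} (hst : ∀ v ∉ rightVerts A, s v = t v)
    (hs : parity G c s ≠ 0) (ht : parity G c t ≠ 0) : ψ s = ψ t := by
  classical
  have hone : ∀ x : ZMod 2, x ≠ 0 → x = 1 := by decide
  have hne : (rightVerts A).Nonempty :=
    (Set.ncard_pos (Set.toFinite _)).1 (Nat.zero_lt_of_lt hcard)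
  obtain ⟨w, hw, hwc⟩ := exists_qubit_of_check hG hA hc hne
  -- These moves generate the changes on `A` that preserve the parity of `c`: a qubit of `c` is
  -- always flipped together with the fixed partner `w`.
  let flip (v : V) : V → ZMod 2 :=
    Pi.single v 1 + if G.Adj (Sum.inr v) (Sum.inl c) then Pi.single w 1 else 0
  have hflip0 : ∀ v, parity G c (flip v) = 0 := by
    intro v
    by_cases h : G.Adj (Sum.inr v) (Sum.inl c)
    · simp only [flip, if_pos h]
      rw [parity_add, parity_single_of_adj h, parity_single_of_adj hwc, CharTwo.add_self_eq_zero]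
    · simp only [flip, if_neg h, add_zero]
      exact parity_single_of_not_adj h
  have hflip : ∀ v ∈ rightVerts A, ∀ s, parity G c s ≠ 0 → ψ (s + flip v) = ψ s := by
    intro v hv s hs
    by_cases h : G.Adj (Sum.inr v) (Sum.inl c)
    · simp only [flip, if_pos h]
      exact groundSpace_flip_pair hG hleft hright hcard hA hψ hv hw hc h hwc hs
    · simp only [flip, if_neg h, add_zero]
      exact groundSpace_flip hG hA hψ hv hc h hs
  have hsum : ∀ T : Finset V, (∀ v ∈ T, v ∈ rightVerts A) →
      ψ (s + ∑ v ∈ T, flip v) = ψ s := by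
    intro T
    induction T using Finset.induction_on with
    | empty => simp
    | insert a T ha ih =>
      intro hT
      rw [Finset.sum_insert ha, add_comm (flip a), ← add_assoc,
        hflip a (hT a (Finset.mem_insert_self _ _)),
        ih fun v hv => hT v (Finset.mem_insert_of_mem hv)]
      rwa [parity_add, parity_sum, Finset.sum_eq_zero fun v _ => hflip0 v, add_zero]
  let T : Finset V := {v | s v ≠ t v}
  have hd : ∑ v ∈ T, (Pi.single v 1 : V → ZMod 2) = s + t := by
    ext u
    have h2 : ∀ x y : ZMod 2, (if x ≠ y then 1 else 0) = x + y := by decide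
    rw [Finset.sum_apply, Pi.add_apply, ← h2]
    simp [T, Pi.single_apply]
  have hcancel : ∀ x y : V → ZMod 2, x + (x + y) = y := by
    intro x y
    ext u
    rw [Pi.add_apply, Pi.add_apply, ← add_assoc, CharTwo.add_self_eq_zero, zero_add]
  have hpd : parity G c (s + t) = 0 := by
    rw [parity_add, hone _ hs, hone _ ht]; decide
  have hT : ∑ v ∈ T, flip v = s + t := by
    simp only [flip]
    rw [Finset.sum_add_distrib, hd, ← Finset.sum_filter, Finset.sum_const]
    -- The copies of `e_w` cancel because `s` and `t` differ on an even number of qubits of `c`.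
    suffices h : (((T.filter fun v => G.Adj (Sum.inr v) (Sum.inl c)).card : ℕ) : ZMod 2) = 0 by
      rw [← Nat.cast_smul_eq_nsmul (ZMod 2), h, zero_smul, add_zero]
    rw [← hpd, ← hd, parity_sum, ← Finset.sum_boole]
    refine Finset.sum_congr rfl fun v _ => ?_
    split_ifs with hv
    · exact (parity_single_of_adj hv).symm
    · exact (parity_single_of_not_adj hv).symm
  have h := hsum T fun v hv => by
    by_contra hvA
    exact (Finset.mem_filter.1 hv).2 (hst v hvA)
  rw [hT, hcancel] at h
  exact h.symm

/-- A ground state of `H'_A` takes the same value on any two frustrated strings that agree off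
the qubits of `A`. -/
theorem groundSpace_const
    (hG : G.IsBipartiteWith (Set.range Sum.inl) (Set.range Sum.inr)) {D Dh : ℕ}
    (hleft : ∀ c : Vh, (checkSupport G c).card ≤ Dh)
    (hright : ∀ v : V, (qubitChecks G v).card ≤ D)
    (hcard : 2 * D * Dh < (rightVerts A).ncard)
    (hA : A.Connected) (hcl : LeftClosed A) (hψ : ψ ∈ groundSpace A)
    {s t : V → ZMod 2} (hst : ∀ v ∉ rightVerts A, s v = t v)
    (hs : Frustrated A s) (ht : Frustrated A t) : ψ s = ψ t := by
  obtain ⟨c, hc, hs⟩ := hs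
  obtain ⟨c', hc', ht⟩ := ht
  have h01 : (0 : ZMod 2) + 1 ≠ 0 := by decide
  have hconst : ∀ c ∈ leftVerts A, ∀ s t : V → ZMod 2, (∀ v ∉ rightVerts A, s v = t v) →
      parity G c s ≠ 0 → parity G c t ≠ 0 → ψ s = ψ t := fun c hc s t =>
    groundSpace_const_of_check hG hleft hright hcard hA hψ hc
  by_cases hs' : parity G c' s = 0
  swap
  · exact hconst c' hc' s t hst hs' ht
  by_cases ht' : parity G c t = 0
  swap
  · exact hconst c hc s t hst hs ht'
  have hoff : ∀ u ∈ rightVerts A, ∀ s : V → ZMod 2, ∀ v ∉ rightVerts A,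
      (s + Pi.single u 1 : V → ZMod 2) v = s v := by
    intro u hu s v hv
    have : v ≠ u := fun h => hv (h ▸ hu)
    simp [this]
  -- What remains is that `s` violates only `c` and `t` only `c'`. A qubit in exactly one of the two
  -- supports, flipped in `s` or in `t`, gives an intermediate string violating both checks.
  have hne : checkSupport G c ≠ checkSupport G c' := by
    intro h
    refine hs ?_
    rw [← hs']
    exact congrArg (fun T => ∑ v ∈ T, s v) h
  by_cases hsub : checkSupport G c' ⊆ checkSupport G c
  · obtain ⟨u, hu, hu'⟩ := Finset.exists_of_ssubset (hsub.ssubset_of_ne hne.symm)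
    rw [mem_checkSupport] at hu hu'
    have huA := hcl.mem_rightVerts hc hu
    trans ψ (t + Pi.single u 1)
    · refine hconst c hc _ _ (fun v hv => (hst v hv).trans (hoff u huA t v hv).symm) hs ?_
      rwa [parity_add_single_of_adj hu, ht']
    · refine hconst c' hc' _ _ (hoff u huA t) ?_ ht
      rwa [parity_add_single_of_not_adj hu']
  · obtain ⟨u, hu, hu'⟩ := Finset.not_subset.1 hsub
    rw [mem_checkSupport] at hu hu'
    have huA := hcl.mem_rightVerts hc' hu
    trans ψ (s + Pi.single u 1)
    · refine hconst c hc _ _ (fun v hv => (hoff u huA s v hv).symm) hs ?_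
      rwa [parity_add_single_of_not_adj hu']
    · refine hconst c' hc' _ _ (fun v hv => (hoff u huA s v hv).trans (hst v hv)) ?_ ht
      rwa [parity_add_single_of_adj hu, hs']

/-! ### The ground space of a union -/

theorem groundSpace_anti {A B : G.Subgraph} (h : A ≤ B) : groundSpace B ≤ groundSpace A := by
  intro ψ hψ
  rw [mem_groundSpace_iff] at hψ ⊢
  exact fun v hv c hc => hψ v (h.1 hv) c (h.1 hc)

/-- For `v` in `B` only, the shared check `c₀` must permit the flip. If it is satisfied, constancy
on `A`-frustrated strings lets `w` be flipped to violate it, and flipped back afterwards. -/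
theorem groundSpace_inf_flip {A B : G.Subgraph} {c₀ : Vh} {w : V}
    (hG : G.IsBipartiteWith (Set.range Sum.inl) (Set.range Sum.inr)) {D Dh : ℕ}
    (hleft : ∀ c : Vh, (checkSupport G c).card ≤ Dh)
    (hright : ∀ v : V, (qubitChecks G v).card ≤ D)
    (hA : A.Connected) (hAcl : LeftClosed A) (hAcard : 2 * D * Dh < (rightVerts A).ncard)
    (hB : B.Connected)
    (hc₀A : c₀ ∈ leftVerts A) (hc₀B : c₀ ∈ leftVerts B)
    (hw : G.Adj (Sum.inr w) (Sum.inl c₀))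
    (hψA : ψ ∈ groundSpace A) (hψB : ψ ∈ groundSpace B) {c : Vh} (hc : c ∈ leftVerts A) {v : V}
    (hv : v ∈ rightVerts A ∨ v ∈ rightVerts B) (hvc : ¬ G.Adj (Sum.inr v) (Sum.inl c))
    {s : V → ZMod 2} (hs : parity G c s ≠ 0) : ψ (s + Pi.single v 1) = ψ s := by
  by_cases hvA : v ∈ rightVerts A
  · exact groundSpace_flip hG hA hψA hvA hc hvc hs
  have hvB := hv.resolve_left hvA
  have hvc₀ : ¬ G.Adj (Sum.inr v) (Sum.inl c₀) := fun h => hvA (hAcl.mem_rightVerts hc₀A h)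
  have hwA := hAcl.mem_rightVerts hc₀A hw
  by_cases hs₀ : parity G c₀ s = 0
  swap
  · exact groundSpace_flip hG hB hψB hvB hc₀B hvc₀ hs₀
  have h1 : ∀ s : V → ZMod 2, parity G c s ≠ 0 → parity G c₀ s = 0 →
      ψ s = ψ (s + Pi.single w 1) := by
    intro s hs hs₀
    refine groundSpace_const hG hleft hright hAcard hA hAcl hψA ?_ ⟨c, hc, hs⟩ ⟨c₀, hc₀A, ?_⟩
    · intro x hx
      have : x ≠ w := fun h => hx (h ▸ hwA)
      simp [this]
    · rw [parity_add_single_of_adj hw, hs₀]; decide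
  rw [h1 s hs hs₀, h1 (s + Pi.single v 1) (by rwa [parity_add_single_of_not_adj hvc])
    (by rwa [parity_add_single_of_not_adj hvc₀]), add_right_comm]
  refine groundSpace_flip hG hB hψB hvB hc₀B hvc₀ ?_
  rw [parity_add_single_of_adj hw, hs₀]; decide

theorem groundSpace_sup {A B : G.Subgraph}
    (hG : G.IsBipartiteWith (Set.range Sum.inl) (Set.range Sum.inr)) {D Dh : ℕ}
    (hleft : ∀ c : Vh, (checkSupport G c).card ≤ Dh)
    (hright : ∀ v : V, (qubitChecks G v).card ≤ D)
    (hA : A.Connected) (hAcl : LeftClosed A) (hAcard : 2 * D * Dh < (rightVerts A).ncard)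
    (hB : B.Connected) (hBcl : LeftClosed B) (hBcard : 2 * D * Dh < (rightVerts B).ncard)
    (hVh : (leftVerts (A ⊓ B)).Nonempty) :
    groundSpace (A ⊔ B) = groundSpace A ⊓ groundSpace B := by
  refine le_antisymm (le_inf (groundSpace_anti le_sup_left) (groundSpace_anti le_sup_right)) ?_
  rintro ψ ⟨hψA, hψB⟩
  obtain ⟨c₀, hc₀A, hc₀B⟩ := hVh
  have hne : (rightVerts A).Nonempty :=
    (Set.ncard_pos (Set.toFinite _)).1 (Nat.zero_lt_of_lt hAcard)
  obtain ⟨w, -, hw⟩ := exists_qubit_of_check hG hA hc₀A hne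
  refine mem_groundSpace_iff.2 fun v hv c hc hd s hs => ?_
  have hvc := not_adj_of_dist_eq_three hd
  rcases hc with hc | hc
  · exact groundSpace_inf_flip hG hleft hright hA hAcl hAcard hB hc₀A hc₀B hw hψA hψB
      hc hv hvc hs
  · exact groundSpace_inf_flip hG hleft hright hB hBcl hBcard hA hc₀B hc₀A hw hψB hψA
      hc (Or.symm hv) hvc hs

end

/-! ### Independent qubits -/

/-- Any set `U` of qubits that are all checked contains a proportion `1 / Dh` of qubits on which
no nonzero bit string satisfies all the checks. -/
theorem exists_isolating_subset {Vh V : Type*} [Fintype V] {G : SimpleGraph (Vh ⊕ V)} {Dh : ℕ}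
    (hleft : ∀ c : Vh, (checkSupport G c).card ≤ Dh) (L : Set Vh) (U : Finset V)
    (hU : ∀ v ∈ U, ∃ c ∈ L, G.Adj (Sum.inr v) (Sum.inl c)) :
    ∃ T ⊆ U, U.card ≤ T.card * Dh ∧ ∀ h : V → ZMod 2, (∀ v ∉ T, h v = 0) →
      (∀ c ∈ L, parity G c h = 0) → h = 0 := by
  classical
  induction U using Finset.strongInduction with
  | H U ih =>
    rcases U.eq_empty_or_nonempty with rfl | ⟨v, hv⟩
    · exact ⟨∅, by simp, by simp, fun h hh _ => funext fun v => hh v (by simp)⟩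
    obtain ⟨c, hc, hvc⟩ := hU v hv
    have hvS : v ∈ checkSupport G c := mem_checkSupport.2 hvc
    -- Greedy choice: keep `v` and discard the rest of the support of `c`, at most `Dh` qubits in
    -- all. Then `v` is the only chosen qubit in `c`, so `c` forces `h v = 0`.
    obtain ⟨T, hTU, hcard, hT⟩ := ih (U \ checkSupport G c)
      (Finset.ssubset_iff_subset_ne.2 ⟨Finset.sdiff_subset, fun h =>
        (Finset.mem_sdiff.1 (h ▸ hv)).2 hvS⟩) fun w hw => hU w (Finset.mem_sdiff.1 hw).1
    have hTS : ∀ w ∈ T, ¬ G.Adj (Sum.inr w) (Sum.inl c) := fun w hw h =>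
      (Finset.mem_sdiff.1 (hTU hw)).2 (mem_checkSupport.2 h)
    refine ⟨insert v T, ?_, ?_, fun h hh hpar => hT h (fun w hw => ?_) hpar⟩
    · exact Finset.insert_subset hv (hTU.trans Finset.sdiff_subset)
    · rw [Finset.card_insert_of_notMem fun h => hTS v h hvc]
      have h1 := Finset.card_sdiff_add_card_inter U (checkSupport G c)
      have h2 := (Finset.card_le_card Finset.inter_subset_right).trans (hleft c)
        (a := (U ∩ checkSupport G c).card)
      rw [add_mul]
      omega
    · by_cases hwv : w = v
      · subst hwv
        have h1 := hpar c hc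
        rw [parity, Finset.sum_eq_single w] at h1
        · exact h1
        · intro u hu huw
          refine hh u fun hu' => ?_
          exact hTS u (Finset.mem_of_mem_insert_of_ne hu' huw) (Finset.mem_filter.1 hu).2
        · exact fun h => absurd hvS h
      · exact hh w (by simp [hwv, hw])

/-! ### Functions on bit strings -/

section

open Classical in
/-- The restriction of `φ` to `C`, extended by zero. -/
noncomputable def restrict {S : Type*} (C : Set S) (φ : EuclideanSpace ℂ S) :
    EuclideanSpace ℂ S :=
  WithLp.toLp 2 fun s => if s ∈ C then φ s else 0

open Classical in
theorem restrict_apply {S : Type*} (C : Set S) (φ : EuclideanSpace ℂ S) (s : S) :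
    restrict C φ s = if s ∈ C then φ s else 0 := rfl

theorem restrict_of_mem {S : Type*} {C : Set S} (φ : EuclideanSpace ℂ S) {s : S}
    (hs : s ∈ C) :
    restrict C φ s = φ s := if_pos hs

theorem restrict_of_notMem {S : Type*} {C : Set S} (φ : EuclideanSpace ℂ S) {s : S}
    (hs : s ∉ C) :
    restrict C φ s = 0 := if_neg hs

variable {S : Type*} [Fintype S]

theorem norm_restrict_add_norm_restrict_compl (C : Set S) (φ : EuclideanSpace ℂ S) :
    ‖restrict C φ‖ ^ 2 + ‖restrict Cᶜ φ‖ ^ 2 = ‖φ‖ ^ 2 := by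
  classical
  simp only [EuclideanSpace.norm_sq_eq]
  rw [← Finset.sum_add_distrib]
  refine Finset.sum_congr rfl fun s _ => ?_
  by_cases hs : s ∈ C <;> simp [restrict_apply, hs]

theorem norm_le_norm_of_apply_le {φ ψ : EuclideanSpace ℂ S} (h : ∀ s, ‖φ s‖ ≤ ‖ψ s‖) :
    ‖φ‖ ≤ ‖ψ‖ := by
  rw [EuclideanSpace.norm_eq, EuclideanSpace.norm_eq]
  exact Real.sqrt_le_sqrt (Finset.sum_le_sum fun s _ => by gcongr; exact h s)

theorem norm_restrict_le (C : Set S) (φ : EuclideanSpace ℂ S) : ‖restrict C φ‖ ≤ ‖φ‖ := by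
  refine norm_le_norm_of_apply_le fun s => ?_
  by_cases hs : s ∈ C
  · rw [restrict_of_mem φ hs]
  · simp [restrict_of_notMem φ hs]

theorem norm_restrict_mono {C E : Set S} (h : C ⊆ E) (φ : EuclideanSpace ℂ S) :
    ‖restrict C φ‖ ≤ ‖restrict E φ‖ := by
  refine norm_le_norm_of_apply_le fun s => ?_
  by_cases hs : s ∈ C
  · rw [restrict_of_mem φ hs, restrict_of_mem φ (h hs)]
  · simp [restrict_of_notMem φ hs]

/-- If `φ` agrees with `f` off a set that carries at most half of the mass of `f`, then
`‖f‖ ≤ √2 ‖φ‖`. -/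
theorem norm_le_sqrt_two_mul {C : Set S} {φ f : EuclideanSpace ℂ S} {u : ℝ} (hu : u ^ 2 ≤ 1 / 2)
    (hf : ‖restrict C f‖ ≤ u * ‖f‖) (hφ : ∀ s ∉ C, φ s = f s) : ‖f‖ ≤ √2 * ‖φ‖ := by
  have h1 : ‖restrict Cᶜ f‖ ≤ ‖φ‖ := by
    refine norm_le_norm_of_apply_le fun s => ?_
    by_cases hs : s ∈ C
    · rw [restrict_of_notMem f (not_not.2 hs)]; simp
    · rw [restrict_of_mem f hs, hφ s hs]
  have h2 := norm_restrict_add_norm_restrict_compl C f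
  have h3 : ‖restrict C f‖ ^ 2 ≤ 1 / 2 * ‖f‖ ^ 2 := by
    refine (pow_le_pow_left₀ (norm_nonneg _) hf 2).trans ?_
    rw [mul_pow]; gcongr
  have h4 : ‖restrict Cᶜ f‖ ^ 2 ≤ ‖φ‖ ^ 2 := by gcongr
  refine abs_le_of_sq_le_sq' ?_ (by positivity) |>.2
  rw [mul_pow, Real.sq_sqrt zero_le_two]
  linarith

/-- The overlap of a function that is `f` off `C` and a function that is `g` off `E`, both of them
zero on `C ∩ E`. -/
theorem norm_inner_le_of_eq_off {C E : Set S} {φ ψ f g : EuclideanSpace ℂ S} {u : ℝ}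
    (hu0 : 0 ≤ u) (hu : u ^ 2 ≤ 1 / 2)
    (hφ : ∀ s ∉ C, φ s = f s) (hψ : ∀ s ∉ E, ψ s = g s)
    (hφ0 : ∀ s ∈ C, s ∈ E → φ s = 0) (hψ0 : ∀ s ∈ C, s ∈ E → ψ s = 0)
    (hfC : ‖restrict C f‖ ≤ u * ‖f‖) (hfE : ‖restrict E f‖ ≤ u * ‖f‖)
    (hgC : ‖restrict C g‖ ≤ u * ‖g‖) (hgE : ‖restrict E g‖ ≤ u * ‖g‖)
    (hfg : ‖inner ℂ f g‖ ≤ u * (u * ‖f‖ + ‖φ‖) * ‖g‖) :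
    ‖inner ℂ φ ψ‖ ≤ 6 * √2 * u * (‖φ‖ * ‖ψ‖) := by
  -- Split over `C \ E`, `E \ C` and the complement of `C ∪ E`, completing the last part to `⟨f,
  -- g⟩`. In units of `√2 * u * ‖φ‖ * ‖ψ‖` the five terms cost 1, 1, 2, 1, 1, whence the 6.
  have hsplit : inner ℂ φ ψ = inner ℂ (restrict C φ) (restrict C g) +
      inner ℂ (restrict E f) (restrict E ψ) + inner ℂ f g -
      inner ℂ (restrict C f) (restrict C g) - inner ℂ (restrict E f) (restrict (E \ C) g) := by
    classical
    simp only [PiLp.inner_apply]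
    simp only [← Finset.sum_add_distrib, ← Finset.sum_sub_distrib]
    refine Finset.sum_congr rfl fun s _ => ?_
    by_cases hC : s ∈ C <;> by_cases hE : s ∈ E
    · simp [restrict_apply, hC, hE, hφ0 s hC hE, hψ0 s hC hE]
    · simp [restrict_apply, hC, hE, hψ s hE]
    · simp [restrict_apply, hC, hE, hφ s hC]
    · simp [restrict_apply, hC, hE, hφ s hC, hψ s hE]
  have hu1 : u * √2 ≤ 1 := by
    refine abs_le_of_sq_le_sq' ?_ zero_le_one |>.2
    rw [mul_pow, Real.sq_sqrt zero_le_two]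
    linarith
  have hf := norm_le_sqrt_two_mul hu hfC hφ
  have hg := norm_le_sqrt_two_mul hu hgE hψ
  have huf : u * ‖f‖ ≤ ‖φ‖ := by
    calc u * ‖f‖ ≤ u * (√2 * ‖φ‖) := by gcongr
      _ = (u * √2) * ‖φ‖ := by ring
      _ ≤ 1 * ‖φ‖ := by gcongr
      _ = ‖φ‖ := one_mul _
  have hcs : ∀ x y : EuclideanSpace ℂ S, ∀ a b : ℝ, ‖x‖ ≤ a → ‖y‖ ≤ b → ‖inner ℂ x y‖ ≤ a * b :=
    fun x y a b hx hy => (norm_inner_le_norm x y).trans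
      (mul_le_mul hx hy (norm_nonneg _) ((norm_nonneg _).trans hx))
  have hg' : u * ‖g‖ ≤ √2 * u * ‖ψ‖ := by
    calc u * ‖g‖ ≤ u * (√2 * ‖ψ‖) := by gcongr
      _ = √2 * u * ‖ψ‖ := by ring
  have hf' : u * ‖f‖ ≤ √2 * u * ‖φ‖ := by
    calc u * ‖f‖ ≤ u * (√2 * ‖φ‖) := by gcongr
      _ = √2 * u * ‖φ‖ := by ring
  have h1 := hcs _ _ _ _ (norm_restrict_le C φ) (hgC.trans hg')
  have h2 := hcs _ _ _ _ (hfE.trans hf') (norm_restrict_le E ψ)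
  have h3 : ‖inner ℂ f g‖ ≤ 2 * ‖φ‖ * (√2 * u * ‖ψ‖) := by
    calc ‖inner ℂ f g‖ ≤ u * (u * ‖f‖ + ‖φ‖) * ‖g‖ := hfg
      _ = (u * ‖f‖ + ‖φ‖) * (u * ‖g‖) := by ring
      _ ≤ (‖φ‖ + ‖φ‖) * (√2 * u * ‖ψ‖) := by gcongr
      _ = _ := by ring
  have h4 := hcs _ _ _ _ (hfC.trans huf) (hgC.trans hg')
  have h5 := hcs _ _ _ _ (hfE.trans huf)
    (((norm_restrict_mono (Set.sdiff_subset (t := C)) g).trans hgE).trans hg')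
  rw [hsplit]
  refine (norm_sub_le _ _).trans ?_
  refine (add_le_add_left ((norm_sub_le _ _).trans (add_le_add_left ((norm_add_le _ _).trans
    (add_le_add_left (norm_add_le _ _) _)) _)) _).trans ?_
  linarith

end

/-! ### Functions independent of some of the qubits -/

section

variable {V : Type*} [Fintype V] [DecidableEq V]

/-- If `k` does not depend on the qubits of `T` and a string in `C` is determined by its values off
`T`, then `C` carries at most a proportion `2 ^ (-|T|)` of the mass of `k`. -/
theorem two_pow_mul_norm_restrict_le {C : Set (V → ZMod 2)} {T : Finset V}
    (hC : ∀ s ∈ C, ∀ t ∈ C, (∀ v ∉ T, s v = t v) → s = t) {k : QubitSpace V}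
    (hk : DependsOn k (T : Set V)ᶜ) : 2 ^ T.card * ‖restrict C k‖ ^ 2 ≤ ‖k‖ ^ 2 := by
  classical
  let glue (p : (V → ZMod 2) × (T → ZMod 2)) : V → ZMod 2 :=
    fun v => if h : v ∈ T then p.2 ⟨v, h⟩ else p.1 v
  have hglue : ∀ p, ∀ v ∉ T, glue p v = p.1 v := fun p v hv => dif_neg hv
  let C' : Finset (V → ZMod 2) := {s | s ∈ C}
  -- Rewriting the `T` bits of the strings of `C` in all ways gives `2 ^ |T|` distinct strings for
  -- each, with no collisions, and `k` is constant on each such family.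
  have hinj : Set.InjOn glue
      ((C' ×ˢ Finset.univ : Finset ((V → ZMod 2) × (T → ZMod 2))) : Set _) := by
    rintro ⟨s, x⟩ hs ⟨t, y⟩ ht hst
    have hs' : s ∈ C := by simpa [C'] using hs
    have ht' : t ∈ C := by simpa [C'] using ht
    have h1 : s = t := hC s hs' t ht' fun v hv =>
      (hglue (s, x) v hv).symm.trans ((congrFun hst v).trans (hglue (t, y) v hv))
    refine Prod.ext h1 (funext fun v => ?_)
    have h2 := congrFun hst v
    simpa [glue] using h2
  have h1 : ∑ p ∈ C' ×ˢ (Finset.univ : Finset (T → ZMod 2)), ‖k (glue p)‖ ^ 2 ≤ ‖k‖ ^ 2 := by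
    rw [EuclideanSpace.norm_sq_eq, ← Finset.sum_image (f := fun s => ‖k s‖ ^ 2) hinj]
    exact Finset.sum_le_univ_sum_of_nonneg fun s => by positivity
  refine le_trans (le_of_eq ?_) h1
  rw [Finset.sum_product, EuclideanSpace.norm_sq_eq, Finset.mul_sum, Finset.sum_filter]
  refine Finset.sum_congr rfl fun s _ => ?_
  by_cases hs : s ∈ C
  · rw [if_pos hs, restrict_of_mem k hs, Finset.sum_congr rfl fun x _ => by
      rw [hk (x := glue (s, x)) (y := s) fun v hv => hglue (s, x) v hv]]
    simp [ZMod.card]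
  · simp [restrict_of_notMem k hs, hs]

/-- The average of `f` over the values of the qubits of `W`. -/
noncomputable def average (W : Set V) (f : QubitSpace V) : QubitSpace V :=
  WithLp.toLp 2 fun s => (Fintype.card (V → ZMod 2) : ℂ)⁻¹ *
    ∑ h : V → ZMod 2, f (s + W.indicator h)

theorem inner_average {W : Set V} {g : QubitSpace V} (hg : DependsOn g Wᶜ) (f : QubitSpace V) :
    inner ℂ (average W f) g = inner ℂ f g := by
  have h1 : ∀ h : V → ZMod 2, ∑ s : V → ZMod 2, g s * star (f (s + W.indicator h)) =
      ∑ s, g s * star (f s) := by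
    intro h
    rw [← Equiv.sum_comp (Equiv.addRight (W.indicator h)) fun s => g s * star (f s)]
    refine Finset.sum_congr rfl fun s _ => ?_
    rw [Equiv.coe_addRight, hg (x := s + W.indicator h) (y := s) fun v hv => by
      simp [Set.indicator_of_notMem hv]]
  have h2 : inner ℂ (average W f) g = (Fintype.card (V → ZMod 2) : ℂ)⁻¹ *
      ∑ h : V → ZMod 2, ∑ s : V → ZMod 2, g s * star (f (s + W.indicator h)) := by
    rw [Finset.sum_comm, PiLp.inner_apply, Finset.mul_sum]
    refine Finset.sum_congr rfl fun s _ => ?_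
    rw [← Finset.mul_sum]
    simp only [average, RCLike.inner_apply, map_mul, map_inv₀, map_natCast, map_sum,
      starRingEnd_apply]
    ring
  rw [h2, Finset.sum_congr rfl fun h _ => h1 h, Finset.sum_const, PiLp.inner_apply, nsmul_eq_mul,
    Finset.card_univ, inv_mul_cancel_left₀ (by exact_mod_cast Fintype.card_ne_zero)]
  rfl

theorem dependsOn_average {U W : Set V} {f : QubitSpace V} (hf : DependsOn f Uᶜ) :
    DependsOn (average W f) (U ∪ W)ᶜ := by
  intro s t hst
  change _ * _ = _ * _
  congr 1
  rw [← Equiv.sum_comp (Equiv.addRight (s - t))]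
  refine Finset.sum_congr rfl fun h _ => hf fun v hv => ?_
  by_cases hW : v ∈ W
  · have h2 : ∀ a b c : ZMod 2, a + (b + (a - c)) = c + b := by decide
    simpa [hW] using h2 _ _ _
  · simp [hW, hst v fun h => h.elim hv hW]

/-- If `φ` is `f` off `C` and `φ` is orthogonal to all the functions of the qubits off `U ∪ W`,
then `f` is nearly orthogonal to the functions of the qubits off `W`. -/
theorem norm_inner_le_of_orthogonal {U W : Set V} {C : Set (V → ZMod 2)}
    {φ f g : QubitSpace V} {u : ℝ} (hu0 : 0 ≤ u) (hφ : ∀ s ∉ C, φ s = f s)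
    (hf : DependsOn f Uᶜ) (hg : DependsOn g Wᶜ)
    (hC : ∀ k : QubitSpace V, DependsOn k Uᶜ → ‖restrict C k‖ ≤ u * ‖k‖)
    (hort : ∀ k : QubitSpace V, DependsOn k (U ∪ W)ᶜ → inner ℂ k φ = 0) :
    ‖inner ℂ f g‖ ≤ u * (u * ‖f‖ + ‖φ‖) * ‖g‖ := by
  set F := average W f with hF
  have hFd : DependsOn F (U ∪ W)ᶜ := dependsOn_average hf
  have hFU : DependsOn F Uᶜ := fun s t h => hFd fun v hv => h v fun hvU => hv (Or.inl hvU)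
  have hFW : DependsOn F Wᶜ := fun s t h => hFd fun v hv => h v fun hvW => hv (Or.inr hvW)
  have h1 : inner ℂ F (f - φ) = inner ℂ (restrict C F) (restrict C f - restrict C φ) := by
    rw [PiLp.inner_apply, PiLp.inner_apply]
    refine Finset.sum_congr rfl fun s _ => ?_
    by_cases hs : s ∈ C
    · simp [restrict_of_mem _ hs]
    · simp [restrict_of_notMem _ hs, hφ s hs]
  -- `‖F‖² = ⟨F, f⟩ = ⟨F, f - φ⟩`, and `f - φ` lives on `C`, where `F` and `f` are both small.
  have h2 : ‖F‖ * ‖F‖ ≤ u * (u * ‖f‖ + ‖φ‖) * ‖F‖ := by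
    calc ‖F‖ * ‖F‖ = ‖inner ℂ F F‖ := by
          rw [inner_self_eq_norm_sq_to_K]; simp [sq]
      _ = ‖inner ℂ F (f - φ)‖ := by
          rw [hF, inner_average hFW, norm_inner_symm, inner_sub_right, hort F hFd, sub_zero]
      _ ≤ ‖restrict C F‖ * ‖restrict C f - restrict C φ‖ := by
          rw [h1]; exact norm_inner_le_norm _ _
      _ ≤ (u * ‖F‖) * (u * ‖f‖ + ‖φ‖) := by
          have h3 := hC F hFU
          have h4 := hC f hf
          have h5 := norm_restrict_le C φ
          have h6 := norm_sub_le (restrict C f) (restrict C φ)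
          gcongr
          linarith
      _ = _ := by ring
  have h3 : ‖F‖ ≤ u * (u * ‖f‖ + ‖φ‖) := by
    rcases (norm_nonneg F).eq_or_lt with h | h
    · rw [← h]; positivity
    · exact le_of_mul_le_mul_right h2 h
  rw [← inner_average hg]
  exact (norm_inner_le_norm _ _).trans (by gcongr)

end

/-- The part of a function of the outer qubits carried by code strings is exponentially small. -/
theorem exists_norm_restrict_code_le {Vh V : Type*} [Fintype V]
    [DecidableEq V] {G : SimpleGraph (Vh ⊕ V)} {A : G.Subgraph}
    (hG : G.IsBipartiteWith (Set.range Sum.inl) (Set.range Sum.inr)) {Dh : ℕ}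
    (hleft : ∀ c : Vh, (checkSupport G c).card ≤ Dh)
    (hA : A.Connected) (hne : (leftVerts A).Nonempty) {M : Set V} (hM : M ⊆ rightVerts A) :
    ∃ r : ℕ, M.ncard ≤ r * Dh ∧ ∀ k : QubitSpace V, DependsOn k Mᶜ →
      2 ^ r * ‖restrict {s | ¬ Frustrated A s} k‖ ^ 2 ≤ ‖k‖ ^ 2 := by
  classical
  obtain ⟨T, hTM, hcard, hT⟩ := exists_isolating_subset hleft (leftVerts A) M.toFinset
    fun v hv => exists_check_of_qubit hG hA (hM (Set.mem_toFinset.1 hv)) hne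
  refine ⟨T.card, by rwa [Set.ncard_eq_toFinset_card'], fun k hk => ?_⟩
  refine two_pow_mul_norm_restrict_le (fun s hs t ht hst => ?_) fun s t hst => hk fun v hv =>
    hst v fun hvT => hv (Set.mem_toFinset.1 (hTM hvT))
  simp only [Frustrated, Set.mem_ofPred_eq, not_exists, not_and, not_not] at hs ht
  -- Two code strings agreeing off `T` differ by a string on `T` that satisfies every check.
  have h0 := hT (s + t) (fun v hv => by
    rw [Pi.add_apply, hst v hv, CharTwo.add_self_eq_zero]) fun c hc => by
    rw [parity_add, hs c hc, ht c hc, add_zero]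
  exact funext fun v => CharTwo.add_eq_zero.1 (congrFun h0 v)

/-! ### Ground states in terms of functions of the outer qubits -/

section

variable {Vh V : Type*} [Fintype Vh] [Fintype V] [DecidableEq V] {G : SimpleGraph (Vh ⊕ V)}
  {A : G.Subgraph}

/-- Take `f s` to be the value of `ψ` after one fixed check has been forced to be violated by
flipping, if necessary, one fixed qubit of it. -/
theorem exists_dependsOn_of_mem_groundSpace
    (hG : G.IsBipartiteWith (Set.range Sum.inl) (Set.range Sum.inr)) {D Dh : ℕ}
    (hleft : ∀ c : Vh, (checkSupport G c).card ≤ Dh)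
    (hright : ∀ v : V, (qubitChecks G v).card ≤ D)
    (hcard : 2 * D * Dh < (rightVerts A).ncard)
    (hA : A.Connected) (hcl : LeftClosed A) (hne : (leftVerts A).Nonempty)
    {ψ : QubitSpace V} (hψ : ψ ∈ groundSpace A) :
    ∃ f : QubitSpace V, DependsOn f (rightVerts A)ᶜ ∧ ∀ s, Frustrated A s → ψ s = f s := by
  obtain ⟨c, hc⟩ := hne
  obtain ⟨u, huA, hu⟩ := exists_qubit_of_check hG hA hc
    ((Set.ncard_pos (Set.toFinite _)).1 (Nat.zero_lt_of_lt hcard))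
  let excite (s : V → ZMod 2) : V → ZMod 2 :=
    if parity G c s ≠ 0 then s else s + Pi.single u 1
  have hexc : ∀ s, Frustrated A (excite s) := by
    intro s
    refine ⟨c, hc, ?_⟩
    by_cases hs : parity G c s = 0
    · simp only [excite, hs, ne_eq, not_true_eq_false, if_false]
      rw [parity_add_single_of_adj hu, hs]
      decide
    · simp [excite, hs]
  have hoff : ∀ s, ∀ v ∉ rightVerts A, excite s v = s v := by
    intro s v hv
    have hvu : v ≠ u := fun h => hv (h ▸ huA)
    simp only [excite]
    split_ifs
    · rfl
    · simp [hvu]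
  refine ⟨WithLp.toLp 2 fun s => ψ (excite s), fun s t hst => ?_, fun s hs => ?_⟩
  · refine groundSpace_const hG hleft hright hcard hA hcl hψ (fun v hv => ?_) (hexc s) (hexc t)
    rw [hoff s v hv, hoff t v hv]
    exact hst v hv
  · exact groundSpace_const hG hleft hright hcard hA hcl hψ (fun v hv => (hoff s v hv).symm) hs
      (hexc s)

theorem mem_groundSpace_of_dependsOn {ψ : QubitSpace V} {f : (V → ZMod 2) → ℂ}
    (hf : DependsOn f (rightVerts A)ᶜ) (h : ∀ s, Frustrated A s → ψ s = f s) :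
    ψ ∈ groundSpace A := by
  refine mem_groundSpace_iff.2 fun v hv c hc hd s hs => ?_
  have hvc := not_adj_of_dist_eq_three hd
  rw [h s ⟨c, hc, hs⟩, h _ ⟨c, hc, by rwa [parity_add_single_of_not_adj hvc]⟩]
  refine hf fun w hw => ?_
  have hwv : w ≠ v := fun h => hw (h ▸ hv)
  simp [hwv]

end

/-! ### The martingale function -/

/-- With `P_N` the projection onto `N` and `M = K ⊓ L`, one has `P_K P_L - P_M = (P_K - P_M)(P_L -
P_M)`, so only vectors of `K` and `L` orthogonal to `M` matter. -/
theorem norm_starProjection_mul_sub_le {E : Type*} [NormedAddCommGroup E] [InnerProductSpace ℂ E]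
    [FiniteDimensional ℂ E] {K L : Submodule ℂ E} {ε : ℝ} (hε : 0 ≤ ε)
    (h : ∀ x ∈ K, ∀ y ∈ L, (∀ z ∈ K ⊓ L, inner ℂ z x = 0) → (∀ z ∈ K ⊓ L, inner ℂ z y = 0) →
      ‖inner ℂ x y‖ ≤ ε * (‖x‖ * ‖y‖)) :
    ‖K.starProjection * L.starProjection - (K ⊓ L).starProjection‖ ≤ ε := by
  set M := K ⊓ L with hM
  have hred : ∀ N : Submodule ℂ E, M ≤ N → ∀ x : E,
      N.starProjection x - M.starProjection x ∈ N ∧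
      (∀ z ∈ M, inner ℂ z (N.starProjection x - M.starProjection x) = 0) ∧
      ‖N.starProjection x - M.starProjection x‖ ≤ ‖x‖ := by
    intro N hN x
    have h1 : M.starProjection (N.starProjection x) = M.starProjection x :=
      congrArg (fun T => T x) (Submodule.starProjection_comp_starProjection_of_le hN)
    refine ⟨N.sub_mem (N.starProjection_apply_mem x) (hN (M.starProjection_apply_mem x)), ?_, ?_⟩
    · intro z hz
      rw [← h1, ← inner_conj_symm, Submodule.starProjection_inner_eq_zero _ z hz, map_zero]
    · rw [← h1]
      have h2 : N.starProjection x - M.starProjection (N.starProjection x) =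
          Mᗮ.starProjection (N.starProjection x) := by
        rw [Submodule.starProjection_orthogonal_val]
      rw [h2]
      exact (Submodule.norm_starProjection_apply_le _ _).trans
        (Submodule.norm_starProjection_apply_le _ _)
  refine ContinuousLinearMap.opNorm_le_bound _ hε fun x => ?_
  set y := (K.starProjection * L.starProjection - M.starProjection) x with hy
  obtain ⟨hK, hKM, hKn⟩ := hred K inf_le_left y
  obtain ⟨hL, hLM, hLn⟩ := hred L inf_le_right x
  have h1 : inner ℂ y y = inner ℂ (K.starProjection y - M.starProjection y)
      (L.starProjection x - M.starProjection x) := by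
    have h2 : inner ℂ (M.starProjection y) (L.starProjection x - M.starProjection x) = 0 :=
      hLM _ (M.starProjection_apply_mem y)
    rw [inner_sub_left, h2, sub_zero, Submodule.inner_starProjection_left_eq_right, map_sub,
      Submodule.starProjection_eq_self_iff.2
        ((inf_le_left : M ≤ K) (M.starProjection_apply_mem x))]
    rfl
  have h3 : ‖y‖ * ‖y‖ ≤ ε * ‖x‖ * ‖y‖ := by
    calc ‖y‖ * ‖y‖ = ‖inner ℂ y y‖ := by rw [inner_self_eq_norm_sq_to_K]; simp [sq]
      _ ≤ ε * (‖K.starProjection y - M.starProjection y‖ *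
          ‖L.starProjection x - M.starProjection x‖) := by rw [h1]; exact h _ hK _ hL hKM hLM
      _ ≤ ε * (‖y‖ * ‖x‖) := by gcongr
      _ = ε * ‖x‖ * ‖y‖ := by ring
  rcases (norm_nonneg y).eq_or_lt with h0 | h0
  · rw [← h0]; positivity
  · exact le_of_mul_le_mul_right h3 h0

section

variable {Vh V : Type*} [Fintype Vh] [Fintype V] [DecidableEq V] {G : SimpleGraph (Vh ⊕ V)}
  {A B : G.Subgraph}

theorem projMeet_groundProj :
    projMeet (groundProj A) (groundProj B) = (groundSpace A ⊓ groundSpace B).starProjection := by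
  simp only [projMeet, groundProj, Submodule.range_starProjection]

/-- A state orthogonal to all the common ground states vanishes on the common code strings, and is
orthogonal to all the functions of the qubits outside `A` and `B`. -/
theorem apply_eq_zero_of_orthogonal {φ : QubitSpace V}
    (hort : ∀ z ∈ groundSpace A ⊓ groundSpace B, inner ℂ z φ = 0) :
    (∀ s, ¬ Frustrated A s → ¬ Frustrated B s → φ s = 0) ∧
      ∀ k : QubitSpace V, DependsOn k (rightVerts A ∪ rightVerts B)ᶜ → inner ℂ k φ = 0 := by
  have hzero : ∀ s, ¬ Frustrated A s → ¬ Frustrated B s → φ s = 0 := by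
    intro s hsA hsB
    have hmem : ∀ A : G.Subgraph, ¬ Frustrated A s →
        (EuclideanSpace.single s 1 : QubitSpace V) ∈ groundSpace A := by
      intro A hs
      refine mem_groundSpace_of_dependsOn (f := fun _ => 0) (fun _ _ _ => rfl) fun t ht => ?_
      have hts : t ≠ s := fun h => hs (h ▸ ht)
      simp [hts]
    have h := hort _ ⟨hmem A hsA, hmem B hsB⟩
    simpa [EuclideanSpace.inner_single_left] using h
  refine ⟨hzero, fun k hk => ?_⟩
  -- Erasing `k` on the common code strings makes it a common ground state, and loses nothing in the
  -- inner product because `φ` vanishes there.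
  have hmem : restrict {s | Frustrated A s ∨ Frustrated B s} k ∈
      groundSpace A ⊓ groundSpace B :=
    ⟨mem_groundSpace_of_dependsOn (f := k)
        (fun s t h => hk fun v hv => h v fun hvA => hv (Or.inl hvA))
        fun s hs => restrict_of_mem k (Or.inl hs),
      mem_groundSpace_of_dependsOn (f := k)
        (fun s t h => hk fun v hv => h v fun hvB => hv (Or.inr hvB))
        fun s hs => restrict_of_mem k (Or.inr hs)⟩
  rw [← hort _ hmem, PiLp.inner_apply, PiLp.inner_apply]
  refine Finset.sum_congr rfl fun s _ => ?_
  by_cases hs : Frustrated A s ∨ Frustrated B s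
  · rw [restrict_of_mem k hs]
  · rw [hzero s (fun h => hs (Or.inl h)) fun h => hs (Or.inr h)]
    simp

theorem martingaleDelta_le
    (hG : G.IsBipartiteWith (Set.range Sum.inl) (Set.range Sum.inr)) {D Dh : ℕ}
    (hleft : ∀ c : Vh, (checkSupport G c).card ≤ Dh)
    (hright : ∀ v : V, (qubitChecks G v).card ≤ D)
    (hA : A.Connected) (hAcl : LeftClosed A) (hAcard : 2 * D * Dh < (rightVerts A).ncard)
    (hB : B.Connected) (hBcl : LeftClosed B) (hBcard : 2 * D * Dh < (rightVerts B).ncard)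
    (hAne : (leftVerts A).Nonempty) (hBne : (leftVerts B).Nonempty)
    (hV : (rightVerts (A ⊓ B)).Nonempty) :
    ∃ r : ℕ, (rightVerts (A ⊓ B)).ncard ≤ r * Dh ∧
      martingaleDelta A B ≤ 6 * √2 * √((1 / 2) ^ r) := by
  obtain ⟨rA, hrA, hmA⟩ := exists_norm_restrict_code_le hG hleft hA hAne
    (M := rightVerts (A ⊓ B)) fun v hv => hv.1
  obtain ⟨rB, hrB, hmB⟩ := exists_norm_restrict_code_le hG hleft hB hBne
    (M := rightVerts (A ⊓ B)) fun v hv => hv.2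
  have hr : (rightVerts (A ⊓ B)).ncard ≤ min rA rB * Dh := by
    rcases min_choice rA rB with h | h <;> rw [h] <;> assumption
  refine ⟨min rA rB, hr, ?_⟩
  set r := min rA rB with hrdef
  -- Nonemptiness of the overlap enters here: it gives `u ^ 2 ≤ 1 / 2`.
  have hr1 : 1 ≤ r := by
    have h0 := ((Set.ncard_pos (Set.toFinite _)).2 hV).trans_le hr
    exact Nat.pos_of_mul_pos_right h0
  set u := √((1 / 2 : ℝ) ^ r) with hudef
  have hu0 : 0 ≤ u := Real.sqrt_nonneg _
  have husq : u ^ 2 = (1 / 2) ^ r := Real.sq_sqrt (by positivity)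
  have hu : u ^ 2 ≤ 1 / 2 := by
    rw [husq]
    exact pow_le_of_le_one (by norm_num) (by norm_num) (by omega)
  have hmass : ∀ n, r ≤ n → ∀ x y : ℝ, 0 ≤ y → 2 ^ n * x ^ 2 ≤ y ^ 2 → x ≤ u * y := by
    intro n hn x y hy h
    refine abs_le_of_sq_le_sq' ?_ (by positivity) |>.2
    have h2 : (2 : ℝ) ^ r * x ^ 2 ≤ y ^ 2 :=
      (mul_le_mul_of_nonneg_right (pow_le_pow_right₀ one_le_two hn) (sq_nonneg x)).trans h
    rw [mul_pow, husq, one_div, inv_pow, inv_mul_eq_div, le_div_iff₀ (by positivity)]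
    linarith
  have hCA : ∀ k : QubitSpace V, DependsOn k (rightVerts (A ⊓ B))ᶜ →
      ‖restrict {s | ¬ Frustrated A s} k‖ ≤ u * ‖k‖ := fun k hk =>
    hmass rA (min_le_left _ _) _ _ (norm_nonneg _) (hmA k hk)
  have hCB : ∀ k : QubitSpace V, DependsOn k (rightVerts (A ⊓ B))ᶜ →
      ‖restrict {s | ¬ Frustrated B s} k‖ ≤ u * ‖k‖ := fun k hk =>
    hmass rB (min_le_right _ _) _ _ (norm_nonneg _) (hmB k hk)
  rw [martingaleDelta, projMeet_groundProj]
  refine norm_starProjection_mul_sub_le (by positivity) fun φ hφ ψ hψ hφo hψo => ?_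
  obtain ⟨f, hf, hφf⟩ :=
    exists_dependsOn_of_mem_groundSpace hG hleft hright hAcard hA hAcl hAne hφ
  obtain ⟨g, hg, hψg⟩ :=
    exists_dependsOn_of_mem_groundSpace hG hleft hright hBcard hB hBcl hBne hψ
  have hinA : ∀ k : QubitSpace V, DependsOn k (rightVerts A)ᶜ →
      DependsOn k (rightVerts (A ⊓ B))ᶜ := fun k hk s t h => hk fun v hv => h v fun h' => hv h'.1
  have hinB : ∀ k : QubitSpace V, DependsOn k (rightVerts B)ᶜ →
      DependsOn k (rightVerts (A ⊓ B))ᶜ := fun k hk s t h => hk fun v hv => h v fun h' => hv h'.2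
  obtain ⟨hφ0, hφort⟩ := apply_eq_zero_of_orthogonal hφo
  obtain ⟨hψ0, -⟩ := apply_eq_zero_of_orthogonal hψo
  have hφf' : ∀ s ∉ {s | ¬ Frustrated A s}, φ s = f s := fun s hs => hφf s (not_not.1 hs)
  exact norm_inner_le_of_eq_off hu0 hu hφf'
    (fun s hs => hψg s (not_not.1 hs)) hφ0 hψ0
    (hCA f (hinA f hf)) (hCB f (hinA f hf)) (hCA g (hinB g hg)) (hCB g (hinB g hg))
    (norm_inner_le_of_orthogonal hu0 hφf' hf hg (fun k hk => hCA k (hinA k hk)) hφort)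

/-- The numerical comparison of `6 √2 · 2 ^ (-r / 2)` with `2 ^ (-n / (4 max D Dh))`. -/
theorem six_sqrt_two_mul_le {n r D Dh : ℕ} (hDh : 0 < Dh) (hn : n ≤ r * Dh) :
    6 * √2 * √((1 / 2) ^ r) ≤
      3 * √2 / (√2 - 1) * (2 : ℝ) ^ (-(n : ℝ) / (4 * (max D Dh : ℕ))) := by
  have hs1 : 1 < √2 := Real.lt_sqrt_of_sq_lt (by norm_num)
  have hs2 : √2 ≤ 3 / 2 := (Real.sqrt_le_left (by norm_num)).2 (by norm_num)
  -- This amounts to `√2 - 1 ≤ 1 / 2`.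
  have h1 : 6 * √2 ≤ 3 * √2 / (√2 - 1) := by
    rw [le_div_iff₀ (by linarith)]
    nlinarith
  have h2 : √((1 / 2 : ℝ) ^ r) = (2 : ℝ) ^ (-(r : ℝ) / 2) := by
    rw [Real.sqrt_eq_rpow, one_div, inv_pow, ← Real.rpow_natCast, ← Real.rpow_neg zero_le_two,
      ← Real.rpow_mul zero_le_two, ← div_eq_mul_inv]
  rw [h2]
  refine mul_le_mul h1 (Real.rpow_le_rpow_of_exponent_le one_le_two ?_) (by positivity)
    (div_nonneg (by positivity) (by linarith))
  have h3 : (n : ℝ) ≤ r * (max D Dh : ℕ) := by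
    exact_mod_cast hn.trans (Nat.mul_le_mul_left _ (le_max_right _ _))
  have h4 : (0 : ℝ) < (max D Dh : ℕ) := by exact_mod_cast hDh.trans_le (le_max_right _ _)
  have h5 : (0 : ℝ) ≤ r * (max D Dh : ℕ) := by positivity
  rw [le_div_iff₀ (by positivity)]
  linarith

end

end DeformedLDPC

theorem mainTheorem4 {Vh V : Type*} [Fintype Vh] [Fintype V] [DecidableEq V]
    (G : SimpleGraph (Vh ⊕ V)) [DecidableRel G.Adj]
    (hG : G.IsBipartiteWith (Set.range Sum.inl) (Set.range Sum.inr))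
    (D Dh : ℕ) (hD : 0 < D) (hDh : 0 < Dh)
    (hleft : ∀ c : Vh, G.degree (Sum.inl c) ≤ Dh)
    (hright : ∀ v : V, G.degree (Sum.inr v) ≤ D)
    (A B : G.Subgraph)
    (hAconn : A.Connected) (hAind : A.IsInduced) (hAclosed : DeformedLDPC.LeftClosed A)
    (hAcard : 2 * D * Dh < (DeformedLDPC.rightVerts A).ncard)
    (hBconn : B.Connected) (hBind : B.IsInduced) (hBclosed : DeformedLDPC.LeftClosed B)
    (hBcard : 2 * D * Dh < (DeformedLDPC.rightVerts B).ncard)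
    (hV : (DeformedLDPC.rightVerts (A ⊓ B)).Nonempty)
    (hVh : (DeformedLDPC.leftVerts (A ⊓ B)).Nonempty) :
    DeformedLDPC.projMeet (DeformedLDPC.groundProj A) (DeformedLDPC.groundProj B)
        = DeformedLDPC.groundProj (A ⊔ B) ∧
      DeformedLDPC.martingaleDelta A B ≤
        3 * √2 / (√2 - 1) *
          (2 : ℝ) ^ (-((DeformedLDPC.rightVerts (A ⊓ B)).ncard : ℝ) / (4 * (max D Dh : ℕ))) := by
  have hl : ∀ c : Vh, (DeformedLDPC.checkSupport G c).card ≤ Dh := fun c =>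
    (DeformedLDPC.card_checkSupport_le c).trans (hleft c)
  have hr : ∀ v : V, (DeformedLDPC.qubitChecks G v).card ≤ D := fun v =>
    (DeformedLDPC.card_qubitChecks_le v).trans (hright v)
  refine ⟨?_, ?_⟩
  · rw [DeformedLDPC.projMeet_groundProj, DeformedLDPC.groundProj]
    simp only [DeformedLDPC.groundSpace_sup hG hl hr hAconn hAclosed hAcard hBconn hBclosed
      hBcard hVh]
  · obtain ⟨r, hn, hδ⟩ := DeformedLDPC.martingaleDelta_le hG hl hr hAconn hAclosed hAcard hBconn
      hBclosed hBcard (hVh.mono fun _ h => h.1) (hVh.mono fun _ h => h.2) hV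
    exact hδ.trans (DeformedLDPC.six_sqrt_two_mul_le hDh hn)
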